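/- Let $n\in\mathbb N$, $0<\nu<1$, $T>0$, let $\mathcal A:\mathbb R^n\to\mathbb R^{n\times n}$, let $S\in\mathbb R^{n\times n}$ be invertible, and put $A(z)=S^{-1}\mathcal A(Sz)S$ and $f(z)=A(z)z$. Assume that $f$ is locally Lipschitz. Consider the quasi-linear Caputo system $z^{(\nu)}(t)=f(z(t))$ with $z(0)\in[z_e](0)=[z_{e,1}](0)\times\dots\times[z_{e,n}](0)$, where the $[z_{e,i}](0)$ are compact real intervals that do not contain $0$. A solution on $[0,T]$ is a continuous $z:[0,T]\to\mathbb R^n$ such that, componentwise, $\frac{d}{dt}\Big(\frac1{\Gamma(1-\nu)}\int_0^t (t-s)^{-\nu}\,(z(s)-z(0))\,ds\Big)=f(z(t))$ for $0<t<T$ (the Caputo derivative of order $\nu$ with base point $0$). Let $E_{\nu,1}(\zeta)=\sum_{k\ge0}\zeta^k/\Gamma(\nu k+1)$ and, for an interval vector $[\Lambda]=\operatorname{diag}([\lambda_1],\dots,[\lambda_n])$ and a set $\tau$ of times, let $\mathbf E_{\nu,1}([\Lambda]\tau^\nu)\,[z_e](0)$ be the product over $i$ of the sets $E_{\nu,1}([\lambda_i]\tau^\nu)\cdot[z_{e,i}](0)=\{E_{\nu,1}(l\,t^\nu)\,y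 : l\in[\lambda_i],\ t\in\tau,\ y\in[z_{e,i}](0)\}$. Let $f_1([\cdot]),\dots,f_n([\cdot])$ be any interval evaluations of the components of $f$, i.e. to each compact box $X\subset\mathbb R^n$ a compact interval $f_i([X])\supseteq\{f_i(z):z\in X\}$ is assigned (for instance the exact range). Let $[\Lambda]^{0}$ be any initial interval vector, and suppose that the iteration $$[\lambda_i]^{\kappa+1}=\frac{f_i\big(\mathbf E_{\nu,1}([\Lambda]^{\kappa}[t]^\nu)\,[z_e](0)\big)}{E_{\nu,1}([\lambda_i]^{\kappa}[t]^\nu)\cdot[z_{e,i}](0)},\qquad i=1,\dots,n,\quad [t]=[0,T],$$ with the quotient of intervals $[a]/[b]=\{a/b : a\in[a],\,b\in[b]\}$, converges to an interval vector $[\Lambda]=\operatorname{diag}([\lambda_1],\dots,[\lambda_n])$, in the sense that the lower and the upper bounds converge for all $i$. Then every state $z(T)$ that is reachable at time $T$, i.e. attained by a solution on $[0,T]$ with $z(0)\in[z_e](0)$, satisfies $$z(T)\in\mathbf E_{\nu,1}([\Lambda]\,T^\nu)\,[z_e](0).$$ -/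

import Mathlib

open Set Filter Topology
open scoped Pointwise

noncomputable section

/-- The two-parameter Mittag-Leffler function
`E_{ν,β}(ζ) = ∑ ζ ^ k / Γ(ν k + β)` of a real argument. -/
def mittagLeffler (ν β ζ : ℝ) : ℝ :=
  ∑' k : ℕ, ζ ^ k / Real.Gamma (ν * k + β)

/-- The Riemann-Liouville integral `(I^α y)(t) = Γ(α)⁻¹ ∫_0^t (t - s)^(α - 1) y(s) ds`
with base point `0`. -/
def fracIntegral (α : ℝ) (y : ℝ → ℝ) (t : ℝ) : ℝ :=
  (Real.Gamma α)⁻¹ * ∫ s in (0 : ℝ)..t, (t - s) ^ (α - 1) * y s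

/-- `x` has the Caputo derivative `d` of order `ν ∈ (0, 1)`, base point `0`, at time `t`:
the function `I^(1-ν) (x - x(0))` has the derivative `d` at `t`.  For absolutely continuous `x`
this function is the primitive of `Γ(1-ν)⁻¹ ∫_0^t (t - s)^(-ν) x'(s) ds`. -/
def HasCaputoDerivAt (ν : ℝ) (x : ℝ → ℝ) (d t : ℝ) : Prop :=
  HasDerivAt (fracIntegral (1 - ν) fun s => x s - x 0) d t

/-- `z` is a solution on `[0, T]` of the Caputo system `z^(ν) = f(z)`. -/
def IsCaputoSolution {n : ℕ} (ν T : ℝ) (f : (Fin n → ℝ) → Fin n → ℝ)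
    (z : ℝ → Fin n → ℝ) : Prop :=
  ContinuousOn z (Icc 0 T) ∧
    ∀ t ∈ Ioo 0 T, ∀ i, HasCaputoDerivAt ν (fun s => z s i) (f (z t) i) t

/-- An interval vector, as the set of its points. -/
def boxSet {n : ℕ} (X : Fin n → NonemptyInterval ℝ) : Set (Fin n → ℝ) :=
  {z | ∀ i, z i ∈ X i}

/-- The states that solutions of `z^(ν) = f(z)` with `z(0)` in the box `Z₀` attain at time `T`. -/
def reachableStates {n : ℕ} (ν T : ℝ) (f : (Fin n → ℝ) → Fin n → ℝ)
    (Z₀ : Fin n → NonemptyInterval ℝ) : Set (Fin n → ℝ) :=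
  {w | ∃ z : ℝ → Fin n → ℝ, IsCaputoSolution ν T f z ∧ z 0 ∈ boxSet Z₀ ∧ z T = w}

/-- The system matrix `A(z) = S⁻¹ 𝒜(S z) S` of the quasi-linear model `x^(ν) = 𝒜(x) x`
after the similarity transformation `x = S z`. -/
def transformedMatrix {n : ℕ} (𝒜 : (Fin n → ℝ) → Matrix (Fin n) (Fin n) ℝ)
    (S : Matrix (Fin n) (Fin n) ℝ) (z : Fin n → ℝ) : Matrix (Fin n) (Fin n) ℝ :=
  S⁻¹ * 𝒜 (S.mulVec z) * S

/-- The right-hand side `f(z) = A(z) z` of a quasi-linear model. -/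
def quasiLinearRHS {n : ℕ} (A : (Fin n → ℝ) → Matrix (Fin n) (Fin n) ℝ)
    (z : Fin n → ℝ) : Fin n → ℝ :=
  (A z).mulVec z

/-- The set `E_{ν,1}([l] τ^ν) = {E_{ν,1}(l t^ν) | l ∈ [l], t ∈ τ}`. -/
def mittagLefflerRange (ν : ℝ) (l : NonemptyInterval ℝ) (τ : Set ℝ) : Set ℝ :=
  image2 (fun a t => mittagLeffler ν 1 (a * t ^ ν)) (l : Set ℝ) τ

/-- The `i`-th component `E_{ν,1}([λ_i] τ^ν) · [z_{e,i}](0)` (product of sets, as in interval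
arithmetic) of the Mittag-Leffler type state enclosure over the times in `τ`. -/
def mlComponent {n : ℕ} (ν : ℝ) (L Z₀ : Fin n → NonemptyInterval ℝ) (τ : Set ℝ) (i : Fin n) :
    Set ℝ :=
  mittagLefflerRange ν (L i) τ * (Z₀ i : Set ℝ)

/-- The Mittag-Leffler type state enclosure `E_{ν,1}([Λ] τ^ν) · [z_e](0)`, `[Λ] = diag [λ_i]`. -/
def mlEnclosure {n : ℕ} (ν : ℝ) (L Z₀ : Fin n → NonemptyInterval ℝ) (τ : Set ℝ) :
    Set (Fin n → ℝ) :=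
  {z | ∀ i, z i ∈ mlComponent ν L Z₀ τ i}

/-- `F` is an interval evaluation of `f`: it assigns to every compact box `[a, b]` an interval
vector that contains the values of `f` on `[a, b]`.  The componentwise exact range and the natural
interval extension are of this kind. -/
def IsIntervalEvaluation {n : ℕ} (f : (Fin n → ℝ) → Fin n → ℝ)
    (F : Set (Fin n → ℝ) → Fin n → NonemptyInterval ℝ) : Prop :=
  ∀ a b : Fin n → ℝ, a ≤ b → ∀ z ∈ Icc a b, ∀ i, f z i ∈ F (Icc a b) i

/-- `L 0, L 1, …` is a run of the iteration
`[λ_i]^(κ+1) = F_i(E_{ν,1}([Λ]^κ [t]^ν) [z_e](0)) / (E_{ν,1}([λ_i]^κ [t]^ν) [z_{e,i}](0))`,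
`[t] = [0, T]`, where `/` is the quotient of sets, as in interval arithmetic. -/
def IsMLIteration {n : ℕ} (ν T : ℝ) (F : Set (Fin n → ℝ) → Fin n → NonemptyInterval ℝ)
    (Z₀ : Fin n → NonemptyInterval ℝ) (L : ℕ → Fin n → NonemptyInterval ℝ) : Prop :=
  ∀ κ i, (L (κ + 1) i : Set ℝ) =
    (F (mlEnclosure ν (L κ) Z₀ (Icc 0 T)) i : Set ℝ) / mlComponent ν (L κ) Z₀ (Icc 0 T) i

/-- Convergence of a sequence of interval vectors: convergence of all lower and upper bounds. -/
def IntervalTendsto {n : ℕ} (L : ℕ → Fin n → NonemptyInterval ℝ)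
    (Llim : Fin n → NonemptyInterval ℝ) : Prop :=
  ∀ i, Tendsto (fun κ => (L κ i).fst) atTop (𝓝 (Llim i).fst) ∧
    Tendsto (fun κ => (L κ i).snd) atTop (𝓝 (Llim i).snd)

end

/-!
The enclosure rests on a maximum principle for the Caputo derivative of merely continuous functions
(`caputoDeriv_ge_of_isMax`): if `p` attains its maximum over `[0, t₁]` at `t₁`, its derivative
there is at least `(p t₁ - p 0) t₁ ^ (-ν) / Γ(1 - ν)`. For the gap `φ = p t₁ - p ≥ 0` and
`K(b) = ∫_0^b (b - s)^(-ν) φ(s) ds`, Fubini's theorem and an elementary antiderivative give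
(`balayage_eq`)
`(t₁ - b)^(ν - 1) K(b) - (1 - ν) ∫_0^b (t₁ - σ)^(ν - 2) K(σ) dσ
  = ∫_0^(b / (t₁ - b)) w^(-ν) (1 + w)⁻¹ φ(b - (t₁ - b) w) dw`.
The right side is nonnegative and tends to `φ(t₁) = 0` as `b ↑ t₁`; the left side has derivative
`(t₁ - b)^(ν - 1) K'(b)`. Hence `K'` cannot be positive near `t₁`. No Hölder regularity of `p` is
needed, and the Caputo equation need not be turned into a Volterra equation.

The function `t ↦ E_{ν,1}(l t^ν)` has Caputo derivative `l` times itself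
(`hasCaputoDerivAt_mittagLeffler`), and the maximum principle shows that `E_{ν,1}` is positive on
the whole real line (`mittagLeffler_pos`), so that no division by zero occurs in the iteration.

Each iterate contains `f_i(x) / r` for all `x` in the preceding enclosure and all `r` in its `i`-th
component. As `f` is continuous, this passes to the limit box (`div_mem_limit_of_isMLIteration`),
without any continuity or monotonicity of the interval evaluation. So on the limit box
`a_i r ≤ f_i(x) ≤ b_i r`, where `a_i`, `b_i` are the endpoints of `[λ_i]` in the order given by the
sign of the initial interval.

It remains to see that a solution never leaves the limit box, although these bounds are available
only inside it. Let `u_i`, `v_i` be the Mittag-Leffler solutions with rates `a_i`, `b_i` and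
initial value `z_i(0)`. If `z` were to touch the barrier `u - W` or `v + W` for the first time,
with `W = ε E_{ν,1}(N t^ν)`, then `z` would be within `W` of the box, and the Lipschitz constant of
`f` would make the Caputo derivative of the touching difference negative for large `N`, against the
maximum principle (`IsCaputoSolution.bounds_of_barrier`). Letting `ε → 0` gives
`u_i ≤ z_i ≤ v_i`, and the intermediate value theorem in the rate `l` yields the enclosure.
-/

open MeasureTheory

/-! ### Integrals with the singular kernel `(t - s) ^ (-ν)` -/

theorem intervalIntegrable_sub_rpow_neg {ν : ℝ} (hν₁ : ν < 1) (t a b : ℝ) :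
    IntervalIntegrable (fun s => (t - s) ^ (-ν)) volume a b := by
  have h := (intervalIntegral.intervalIntegrable_rpow' (a := t - a) (b := t - b)
    (r := -ν) (by linarith)).comp_sub_left t
  simpa using h

theorem intervalIntegrable_kernel_mul {ν : ℝ} (hν₁ : ν < 1) {φ : ℝ → ℝ} {t : ℝ} (ht : 0 ≤ t)
    (hφ : ContinuousOn φ (Icc 0 t)) :
    IntervalIntegrable (fun s => (t - s) ^ (-ν) * φ s) volume 0 t :=
  (intervalIntegrable_sub_rpow_neg hν₁ t 0 t).mul_continuousOn (by rwa [uIcc_of_le ht])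

/-- The exponents `ν - 2` and `-ν` add up to `-2`, so the integrand is a multiple of the derivative
of a power of `(σ - s) / (t - σ)`. -/
theorem integral_sub_rpow_mul_sub_rpow {ν s b t : ℝ} (hν₁ : ν < 1) (hsb : s ≤ b)
    (hbt : b < t) :
    ∫ σ in s..b, (t - σ) ^ (ν - 2) * (σ - s) ^ (-ν) =
      ((b - s) / (t - b)) ^ (1 - ν) / ((1 - ν) * (t - s)) := by
  have h1ν : 0 < 1 - ν := by linarith
  have hcont : ContinuousOn (fun σ => ((σ - s) / (t - σ)) ^ (1 - ν) / ((1 - ν) * (t - s)))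
      (Icc s b) := by
    refine ContinuousOn.div_const (ContinuousOn.rpow_const ?_ fun x _ => Or.inr h1ν.le) _
    exact ContinuousOn.div (by fun_prop) (by fun_prop) fun x hx => by linarith [hx.2]
  have hder : ∀ σ ∈ Ioo s b,
      HasDerivAt (fun σ => ((σ - s) / (t - σ)) ^ (1 - ν) / ((1 - ν) * (t - s)))
        ((t - σ) ^ (ν - 2) * (σ - s) ^ (-ν)) σ := by
    intro σ hσ
    have h1 : 0 < σ - s := by linarith [hσ.1]
    have h2 : 0 < t - σ := by linarith [hσ.2]
    have h3 : 0 < t - s := by linarith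
    have hq : HasDerivAt (fun σ => (σ - s) / (t - σ))
        ((1 * (t - σ) - (σ - s) * (-1)) / (t - σ) ^ 2) σ :=
      ((hasDerivAt_id σ).sub_const s).div ((hasDerivAt_id σ).const_sub t) h2.ne'
    convert! (hq.rpow_const (p := 1 - ν) (Or.inl (by positivity))).div_const _ using 1
    have e1 : (1 - ν - 1) = -ν := by ring
    rw [e1, Real.div_rpow h1.le h2.le, Real.rpow_sub h2, Real.rpow_neg h2.le]
    have : (t - σ) ^ ν ≠ 0 := by positivity
    norm_num
    field_simp
  have h0 : (0:ℝ) ^ (1 - ν) = 0 := Real.zero_rpow h1ν.ne'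
  rw [intervalIntegral.integral_eq_sub_of_hasDerivAt_of_le hsb hcont hder]
  · simp [h0]
  · refine IntervalIntegrable.continuousOn_mul ?_ ?_
    · have h := (intervalIntegral.intervalIntegrable_rpow' (a := s - s) (b := b - s)
        (r := -ν) (by linarith)).comp_sub_right s
      simpa using h
    · rw [uIcc_of_le hsb]
      refine ContinuousOn.rpow_const (by fun_prop) fun x hx => Or.inl ?_
      linarith [hx.2]

/-- Exchange of the order of integration over the triangle `0 < s < σ < b`; the inner integral in
`σ` is then elementary. -/
theorem integral_kernel_fubini {ν b t : ℝ} (hν₀ : 0 < ν) (hν₁ : ν < 1) (hb : 0 < b) (hbt : b < t)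
    {φ : ℝ → ℝ} (hφ : Continuous φ) :
    IntervalIntegrable
      (fun σ => (t - σ) ^ (ν - 2) * ∫ s in (0 : ℝ)..σ, (σ - s) ^ (-ν) * φ s) volume 0 b ∧
    ∫ σ in (0 : ℝ)..b, (t - σ) ^ (ν - 2) * (∫ s in (0 : ℝ)..σ, (σ - s) ^ (-ν) * φ s) =
      ∫ s in (0 : ℝ)..b, φ s * (((b - s) / (t - b)) ^ (1 - ν) / ((1 - ν) * (t - s))) := by
  -- The truncated kernel and data are integrable on the line, and `c` is bounded because `b < t`.
  set k : ℝ → ℝ := (Ioc 0 b).indicator fun w => w ^ (-ν) with hk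
  set φ₁ : ℝ → ℝ := (Ioc 0 b).indicator φ with hφ₁
  set c : ℝ → ℝ := (Ioc 0 b).indicator fun σ => (t - σ) ^ (ν - 2) with hc
  have hki : Integrable k := by
    rw [hk, integrable_indicator_iff measurableSet_Ioc,
      ← intervalIntegrable_iff_integrableOn_Ioc_of_le hb.le]
    exact intervalIntegral.intervalIntegrable_rpow' (by linarith)
  have hφi : Integrable φ₁ := by
    rw [hφ₁, integrable_indicator_iff measurableSet_Ioc,
      ← intervalIntegrable_iff_integrableOn_Ioc_of_le hb.le]
    exact hφ.intervalIntegrable _ _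
  have hconv : Integrable (fun p : ℝ × ℝ => φ₁ p.2 * k (p.1 - p.2)) (volume.prod volume) :=
    hφi.convolution_integrand (ContinuousLinearMap.mul ℝ ℝ) hki
  have hcm : Measurable c :=
    Measurable.indicator (by fun_prop) measurableSet_Ioc
  have hcb : ∀ σ, ‖c σ‖ ≤ (t - b) ^ (ν - 2) := by
    intro σ
    by_cases hσ : σ ∈ Ioc 0 b
    · have : 0 < t - σ := by linarith [hσ.2]
      rw [hc, indicator_of_mem hσ, Real.norm_of_nonneg (by positivity)]
      exact Real.rpow_le_rpow_of_nonpos (by linarith) (by linarith [hσ.2]) (by linarith)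
    · have : 0 < t - b := by linarith
      rw [hc, indicator_of_notMem hσ, norm_zero]
      positivity
  have hG : Integrable (fun p : ℝ × ℝ => c p.1 * (φ₁ p.2 * k (p.1 - p.2)))
      (volume.prod volume) :=
    hconv.bdd_mul (c := (t - b) ^ (ν - 2)) (hcm.comp measurable_fst).aestronglyMeasurable
      (Eventually.of_forall fun p => hcb p.1)
  have hleft : ∀ σ, ∫ s, c σ * (φ₁ s * k (σ - s)) = (Ioc 0 b).indicator
      (fun σ => (t - σ) ^ (ν - 2) * ∫ s in (0 : ℝ)..σ, (σ - s) ^ (-ν) * φ s) σ := by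
    intro σ
    by_cases hσ : σ ∈ Ioc 0 b
    · rw [integral_const_mul, indicator_of_mem hσ, hc, indicator_of_mem hσ,
        intervalIntegral.integral_of_le hσ.1.le, ← integral_indicator measurableSet_Ioc]
      congr 2
      ext s
      simp only [hφ₁, hk, indicator_apply, mem_Ioc]
      have := hσ.1
      have := hσ.2
      by_cases h1 : 0 < s
      · by_cases h2 : s < σ
        · rw [if_pos ⟨h1, by linarith⟩, if_pos ⟨by linarith, by linarith⟩, if_pos ⟨h1, h2.le⟩]
          ring
        -- On the diagonal `s = σ` both sides vanish, as `0 ^ (-ν) = 0`.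
        · rw [if_neg (c := 0 < σ - s ∧ _) (by intro h; linarith [h.1])]
          rcases eq_or_lt_of_le (not_lt.1 h2) with h3 | h3
          · simp [h3, Real.zero_rpow (neg_ne_zero.2 hν₀.ne')]
          · rw [if_neg (c := 0 < s ∧ s ≤ σ) (by intro h; linarith [h.2])]
            simp
      · rw [if_neg (by tauto), if_neg (c := 0 < s ∧ s ≤ σ) (by tauto)]
        simp
    · simp [hc, indicator_of_notMem hσ]
  have hright : ∀ s, ∫ σ, c σ * (φ₁ s * k (σ - s)) = (Ioc 0 b).indicator
      (fun s => φ s * (((b - s) / (t - b)) ^ (1 - ν) / ((1 - ν) * (t - s)))) s := by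
    intro s
    by_cases hs : s ∈ Ioc 0 b
    · rw [indicator_of_mem hs, hφ₁, indicator_of_mem hs,
        ← integral_sub_rpow_mul_sub_rpow hν₁ hs.2 hbt, intervalIntegral.integral_of_le hs.2,
        ← integral_indicator measurableSet_Ioc, ← integral_const_mul]
      congr 1
      ext σ
      simp only [hc, hk, indicator_apply, mem_Ioc]
      have := hs.1
      have := hs.2
      by_cases h1 : s < σ
      · by_cases h2 : σ ≤ b
        · rw [if_pos ⟨by linarith, h2⟩, if_pos ⟨by linarith, by linarith⟩, if_pos ⟨h1, h2⟩]
          ring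
        · rw [if_neg (by tauto), if_neg (c := s < σ ∧ σ ≤ b) (by tauto)]
          simp
      · rw [if_neg (c := 0 < σ - s ∧ _) (by intro h; linarith [h.1]),
          if_neg (c := s < σ ∧ σ ≤ b) (by tauto)]
        simp
    · simp [hφ₁, indicator_of_notMem hs]
  constructor
  · rw [intervalIntegrable_iff_integrableOn_Ioc_of_le hb.le,
      ← integrable_indicator_iff measurableSet_Ioc]
    refine hG.integral_prod_left.congr (Eventually.of_forall fun σ => ?_)
    exact hleft σ
  · have hswap := integral_integral_swap (f := fun σ s => c σ * (φ₁ s * k (σ - s))) hG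
    simp only [hleft, hright] at hswap
    rwa [integral_indicator measurableSet_Ioc, integral_indicator measurableSet_Ioc,
      ← intervalIntegral.integral_of_le hb.le, ← intervalIntegral.integral_of_le hb.le] at hswap

/-! ### The balayage identity -/

/-- The left-hand side is, up to the factor `Γ(1 - ν)`, what integration by parts makes of
`∫_0^b (t - σ)^(ν - 1) Y'(σ) dσ` for `Y = I^(1-ν) φ`. The right-hand side writes it as an integral
of `φ` over `[0, b]` with nonnegative weights. -/
theorem balayage_eq {ν b t : ℝ} (hν₀ : 0 < ν) (hν₁ : ν < 1) (hb : 0 < b) (hbt : b < t)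
    {φ : ℝ → ℝ} (hφ : Continuous φ) :
    (t - b) ^ (ν - 1) * (∫ s in (0 : ℝ)..b, (b - s) ^ (-ν) * φ s) -
      (1 - ν) * ∫ σ in (0 : ℝ)..b,
        (t - σ) ^ (ν - 2) * (∫ s in (0 : ℝ)..σ, (σ - s) ^ (-ν) * φ s) =
    ∫ w in (0 : ℝ)..(b / (t - b)), w ^ (-ν) * (1 + w)⁻¹ * φ (b - (t - b) * w) := by
  have hd : 0 < t - b := by linarith
  have h1ν : 0 < 1 - ν := by linarith
  rw [(integral_kernel_fubini hν₀ hν₁ hb hbt hφ).2, ← intervalIntegral.integral_const_mul,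
    ← intervalIntegral.integral_const_mul, ← intervalIntegral.integral_sub]
  -- The substitution `s = b - (t - b) * w`.
  · have hsub := intervalIntegral.integral_comp_sub_mul (a := 0) (b := b / (t - b))
      (fun s => (t - b) ^ (1 + ν) * ((b - s) ^ (-ν) * (t - s)⁻¹ * φ s)) hd.ne' b
    have e1 : b - (t - b) * (b / (t - b)) = 0 := by field_simp; ring
    have e2 : b - (t - b) * 0 = b := by ring
    rw [e1, e2] at hsub
    symm
    rw [intervalIntegral.integral_congr (g := fun w => (t - b) ^ (1 + ν) *
      ((b - (b - (t - b) * w)) ^ (-ν) * (t - (b - (t - b) * w))⁻¹ * φ (b - (t - b) * w))),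
      hsub, smul_eq_mul, ← intervalIntegral.integral_const_mul]
    · symm
      refine intervalIntegral.integral_congr_Ioo_of_le hb.le fun s hs => ?_
      have h1 : 0 < b - s := by linarith [hs.2]
      have h2 : 0 < t - s := by linarith [hs.2]
      rw [Real.div_rpow h1.le hd.le, Real.rpow_sub h1, Real.rpow_sub hd, Real.rpow_sub hd,
        Real.rpow_neg h1.le, Real.rpow_add hd, Real.rpow_one, Real.rpow_one]
      have : (t - b) ^ ν ≠ 0 := by positivity
      have : (b - s) ^ ν ≠ 0 := by positivity
      field_simp
      ring
    · intro w hw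
      rw [uIcc_of_le (by positivity)] at hw
      have hw0 := hw.1
      have h1 : b - (b - (t - b) * w) = (t - b) * w := by ring
      have h2 : t - (b - (t - b) * w) = (t - b) * (1 + w) := by ring
      have h3 : 0 < 1 + w := by linarith
      simp only
      rw [h1, h2, Real.mul_rpow hd.le hw0, Real.rpow_neg hd.le, Real.rpow_add hd, Real.rpow_one]
      have : (t - b) ^ ν ≠ 0 := by positivity
      field_simp
  · exact (intervalIntegrable_kernel_mul hν₁ hb.le hφ.continuousOn).const_mul _
  · refine (ContinuousOn.intervalIntegrable ?_).const_mul _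
    rw [uIcc_of_le hb.le]
    refine hφ.continuousOn.mul (ContinuousOn.div (ContinuousOn.rpow_const
      (by fun_prop) fun x _ => Or.inr h1ν.le) (by fun_prop) fun x hx => ?_)
    have := hx.2
    have : 0 < t - x := by linarith
    positivity

theorem integrableOn_rpow_mul_inv_one_add {ν : ℝ} (hν₀ : 0 < ν) (hν₁ : ν < 1) :
    IntegrableOn (fun w : ℝ => w ^ (-ν) * (1 + w)⁻¹) (Ioi 0) := by
  have hm : Measurable fun w : ℝ => w ^ (-ν) * (1 + w)⁻¹ := by fun_prop
  rw [← Ioc_union_Ioi_eq_Ioi zero_le_one]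
  refine IntegrableOn.union ?_ ?_
  · have h : IntegrableOn (fun w : ℝ => w ^ (-ν)) (Ioc 0 1) :=
      (intervalIntegrable_iff_integrableOn_Ioc_of_le zero_le_one).1
        (intervalIntegral.intervalIntegrable_rpow' (by linarith))
    refine Integrable.mono' h hm.aestronglyMeasurable ?_
    refine (ae_restrict_iff' measurableSet_Ioc).2 (Eventually.of_forall fun w hw => ?_)
    have hw0 := hw.1
    rw [Real.norm_of_nonneg (by positivity)]
    exact mul_le_of_le_one_right (by positivity) (inv_le_one_of_one_le₀ (by linarith))
  · have h : IntegrableOn (fun w : ℝ => w ^ (-ν - 1)) (Ioi 1) :=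
      integrableOn_Ioi_rpow_of_lt (by linarith) zero_lt_one
    refine Integrable.mono' h hm.aestronglyMeasurable ?_
    refine (ae_restrict_iff' measurableSet_Ioi).2 (Eventually.of_forall fun w hw => ?_)
    have hw0 : 0 < w := lt_trans zero_lt_one hw
    rw [Real.norm_of_nonneg (by positivity), Real.rpow_sub hw0, Real.rpow_one, div_eq_mul_inv]
    gcongr
    linarith

/-- The weights concentrate at `t` as `b ↑ t`. -/
theorem tendsto_balayage {ν t C : ℝ} (hν₀ : 0 < ν) (hν₁ : ν < 1) (ht : 0 < t)
    {φ : ℝ → ℝ} (hφ : Continuous φ) (hC : ∀ s, |φ s| ≤ C) (hφt : φ t = 0) :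
    Tendsto (fun b => ∫ w in (0 : ℝ)..(b / (t - b)),
      w ^ (-ν) * (1 + w)⁻¹ * φ (b - (t - b) * w)) (𝓝[<] t) (𝓝 0) := by
  have hmem : ∀ᶠ b in 𝓝[<] t, b ∈ Ioo 0 t := Ioo_mem_nhdsLT ht
  have key : Tendsto (fun b => ∫ w in Ioi (0 : ℝ), (Ioc 0 (b / (t - b))).indicator
      (fun w => w ^ (-ν) * (1 + w)⁻¹ * φ (b - (t - b) * w)) w) (𝓝[<] t)
      (𝓝 (∫ _ in Ioi (0 : ℝ), (0 : ℝ))) := by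
    refine tendsto_integral_filter_of_dominated_convergence
      (fun w => w ^ (-ν) * (1 + w)⁻¹ * C) (Eventually.of_forall fun b => ?_)
      (Eventually.of_forall fun b => ?_)
      ((integrableOn_rpow_mul_inv_one_add hν₀ hν₁).mul_const C) ?_
    · refine (Measurable.indicator ?_ measurableSet_Ioc).aestronglyMeasurable
      have := hφ.measurable
      fun_prop
    · refine (ae_restrict_iff' measurableSet_Ioi).2 (Eventually.of_forall fun w hw => ?_)
      have hw0 : 0 < w := hw
      have hC0 : 0 ≤ C := (abs_nonneg _).trans (hC 0)
      refine (norm_indicator_le_norm_self _ _).trans ?_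
      rw [norm_mul, Real.norm_of_nonneg (by positivity)]
      gcongr
      exact hC _
    · refine Eventually.of_forall fun w => ?_
      have h1 : Tendsto (fun b => w ^ (-ν) * (1 + w)⁻¹ * φ (b - (t - b) * w)) (𝓝[<] t)
          (𝓝 0) := by
        have : Continuous fun b => w ^ (-ν) * (1 + w)⁻¹ * φ (b - (t - b) * w) := by fun_prop
        have h := this.tendsto t
        simp only [sub_self, zero_mul, sub_zero, hφt, mul_zero] at h
        exact h.mono_left nhdsWithin_le_nhds
      refine squeeze_zero_norm (fun b => norm_indicator_le_norm_self _ _) ?_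
      simpa using h1.norm
  rw [integral_zero] at key
  refine key.congr' ?_
  filter_upwards [hmem] with b hb
  have : 0 < b / (t - b) := div_pos hb.1 (by linarith [hb.2])
  rw [setIntegral_indicator measurableSet_Ioc, intervalIntegral.integral_of_le this.le,
    inter_eq_right.2 Ioc_subset_Ioi_self]

/-- A nonnegative `φ` that vanishes at `t` cannot have an integral `∫_0^σ (σ - s)^(-ν) φ(s) ds`
that increases strictly up to time `t`: the expression of `balayage_eq` would be nonnegative,
strictly increasing and would tend to `0`. -/
theorem not_strictly_increasing_kernelIntegral {ν a t C : ℝ} (hν₀ : 0 < ν) (hν₁ : ν < 1)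
    (ha : 0 < a) (hat : a < t) {φ K' : ℝ → ℝ} (hφ : Continuous φ) (hC : ∀ s, |φ s| ≤ C)
    (hφ₀ : ∀ s, 0 ≤ φ s) (hφt : φ t = 0)
    (hder : ∀ σ ∈ Ioo 0 t,
      HasDerivAt (fun σ => ∫ s in (0 : ℝ)..σ, (σ - s) ^ (-ν) * φ s) (K' σ) σ)
    (hpos : ∀ σ ∈ Ioo a t, 0 < K' σ) : False := by
  set K : ℝ → ℝ := fun σ => ∫ s in (0 : ℝ)..σ, (σ - s) ^ (-ν) * φ s with hK
  set D : ℝ → ℝ := fun b => (t - b) ^ (ν - 1) * K b -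
    (1 - ν) * ∫ σ in (0 : ℝ)..b, (t - σ) ^ (ν - 2) * K σ with hD
  have hDeq : ∀ b ∈ Ioo 0 t, D b = ∫ w in (0 : ℝ)..(b / (t - b)),
      w ^ (-ν) * (1 + w)⁻¹ * φ (b - (t - b) * w) := fun b hb =>
    balayage_eq hν₀ hν₁ hb.1 hb.2 hφ
  have hDlim : Tendsto D (𝓝[<] t) (𝓝 0) := by
    refine (tendsto_balayage hν₀ hν₁ (ha.trans hat) hφ hC hφt).congr' ?_
    filter_upwards [Ioo_mem_nhdsLT (ha.trans hat)] with b hb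
    exact (hDeq b hb).symm
  have hDnn : ∀ b ∈ Ioo 0 t, 0 ≤ D b := by
    intro b hb
    rw [hDeq b hb]
    have : 0 < b / (t - b) := div_pos hb.1 (by linarith [hb.2])
    refine intervalIntegral.integral_nonneg this.le fun w hw => ?_
    have := hw.1
    have := hφ₀ (b - (t - b) * w)
    positivity
  have hDder : ∀ b ∈ Ioo 0 t, HasDerivAt D ((t - b) ^ (ν - 1) * K' b) b := by
    intro b hb
    have hd : 0 < t - b := by linarith [hb.2]
    have hcont : ContinuousOn (fun σ => (t - σ) ^ (ν - 2) * K σ) (Ioo 0 t) := by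
      intro σ hσ
      refine ContinuousAt.continuousWithinAt (ContinuousAt.mul (ContinuousAt.rpow_const
        (by fun_prop) (Or.inl ?_)) (hder σ hσ).continuousAt)
      linarith [hσ.2]
    have h2 : HasDerivAt (fun b => ∫ σ in (0 : ℝ)..b, (t - σ) ^ (ν - 2) * K σ)
        ((t - b) ^ (ν - 2) * K b) b :=
      intervalIntegral.integral_hasDerivAt_right (integral_kernel_fubini hν₀ hν₁ hb.1 hb.2 hφ).1
        (hcont.stronglyMeasurableAtFilter isOpen_Ioo b hb)
        (hcont.continuousAt (isOpen_Ioo.mem_nhds hb))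
    have h1 : HasDerivAt (fun b => (t - b) ^ (ν - 1)) (-1 * (ν - 1) * (t - b) ^ (ν - 1 - 1)) b :=
      ((hasDerivAt_id b).const_sub t).rpow_const (Or.inl hd.ne')
    refine ((h1.mul (hder b hb)).sub (h2.const_mul (1 - ν))).congr_deriv ?_
    rw [show ν - 1 - 1 = ν - 2 by ring]
    simp only [hK]
    ring
  have hmono : StrictMonoOn D (Ico a t) := by
    refine strictMonoOn_of_deriv_pos (convex_Ico a t) (fun b hb =>
      (hDder b ⟨ha.trans_le hb.1, hb.2⟩).continuousAt.continuousWithinAt) fun b hb => ?_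
    rw [interior_Ico] at hb
    rw [(hDder b ⟨ha.trans hb.1, hb.2⟩).deriv]
    have : 0 < t - b := by linarith [hb.2]
    have := hpos b hb
    positivity
  obtain ⟨c, hac, hct⟩ := exists_between hat
  have hDc : 0 < D c := (hDnn a ⟨ha, hat⟩).trans_lt
    (hmono ⟨le_rfl, hat⟩ ⟨hac.le, hct⟩ hac)
  have : D c ≤ 0 := by
    refine ge_of_tendsto hDlim ?_
    filter_upwards [Ioo_mem_nhdsLT hct] with b hb
    exact (hmono ⟨hac.le, hct⟩ ⟨hac.le.trans hb.1.le, hb.2⟩ hb.1).le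
  linarith

/-! ### The maximum principle for the Caputo derivative -/

theorem fracIntegral_one_sub (ν : ℝ) (y : ℝ → ℝ) (t : ℝ) :
    fracIntegral (1 - ν) y t =
      (Real.Gamma (1 - ν))⁻¹ * ∫ s in (0 : ℝ)..t, (t - s) ^ (-ν) * y s := by
  rw [fracIntegral, show 1 - ν - 1 = -ν by ring]

theorem fracIntegral_sub {ν t : ℝ} (hν₁ : ν < 1) (ht : 0 ≤ t) {x y : ℝ → ℝ}
    (hx : ContinuousOn x (Icc 0 t)) (hy : ContinuousOn y (Icc 0 t)) :
    fracIntegral (1 - ν) (fun s => x s - y s) t =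
      fracIntegral (1 - ν) x t - fracIntegral (1 - ν) y t := by
  simp only [fracIntegral_one_sub, mul_sub]
  rw [intervalIntegral.integral_sub (intervalIntegrable_kernel_mul hν₁ ht hx)
    (intervalIntegrable_kernel_mul hν₁ ht hy), mul_sub]

theorem fracIntegral_const_mul (α c : ℝ) (x : ℝ → ℝ) (t : ℝ) :
    fracIntegral α (fun s => c * x s) t = c * fracIntegral α x t := by
  simp only [fracIntegral, mul_left_comm _ c, intervalIntegral.integral_const_mul]

theorem HasCaputoDerivAt.const_mul {ν d t : ℝ} {x : ℝ → ℝ} (c : ℝ)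
    (hx : HasCaputoDerivAt ν x d t) : HasCaputoDerivAt ν (fun s => c * x s) (c * d) t := by
  refine (HasDerivAt.const_mul c hx).congr_of_eventuallyEq (Eventually.of_forall fun r => ?_)
  simp only [← mul_sub, fracIntegral_const_mul]

theorem HasCaputoDerivAt.sub {ν T t d e : ℝ} (hν₁ : ν < 1) {x y : ℝ → ℝ}
    (hx : ContinuousOn x (Icc 0 T)) (hy : ContinuousOn y (Icc 0 T)) (ht : t ∈ Ioo 0 T)
    (hxd : HasCaputoDerivAt ν x d t) (hye : HasCaputoDerivAt ν y e t) :
    HasCaputoDerivAt ν (fun s => x s - y s) (d - e) t := by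
  refine (HasDerivAt.sub hxd hye).congr_of_eventuallyEq ?_
  filter_upwards [isOpen_Ioo.mem_nhds ht] with r hr
  have hsub : Icc 0 r ⊆ Icc 0 T := Icc_subset_Icc_right hr.2.le
  have h := fracIntegral_sub hν₁ hr.1.le ((hx.mono hsub).sub continuousOn_const)
    (y := fun s => y s - y 0) ((hy.mono hsub).sub continuousOn_const) (x := fun s => x s - x 0)
  simp only [Pi.sub_apply]
  rw [← h]
  congr 1
  ext s
  ring

theorem integral_sub_rpow_neg {ν t : ℝ} (hν₁ : ν < 1) :
    ∫ s in (0 : ℝ)..t, (t - s) ^ (-ν) = t ^ (1 - ν) / (1 - ν) := by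
  rw [intervalIntegral.integral_comp_sub_left (fun s => s ^ (-ν)) t, sub_self, sub_zero,
    integral_rpow (Or.inl (by linarith)), show -ν + 1 = 1 - ν by ring,
    Real.zero_rpow (by linarith), sub_zero]

/-- Maximum principle: if `p` is maximal over `[0, t₁]` at the right end `t₁`, its Caputo derivative
`q` is bounded below there. The equation is only used before `t₁`, and `q` need only be continuous
from the left at `t₁`. -/
theorem caputoDeriv_ge_of_isMax {ν t₁ : ℝ} (hν₀ : 0 < ν) (hν₁ : ν < 1) (ht₁ : 0 < t₁)
    {p q : ℝ → ℝ} (hp : ContinuousOn p (Icc 0 t₁)) (hq : ContinuousWithinAt q (Iio t₁) t₁)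
    (hder : ∀ t ∈ Ioo 0 t₁, HasCaputoDerivAt ν p (q t) t)
    (hmax : ∀ s ∈ Icc 0 t₁, p s ≤ p t₁) :
    (p t₁ - p 0) * t₁ ^ (-ν) / Real.Gamma (1 - ν) ≤ q t₁ := by
  have hΓ : 0 < Real.Gamma (1 - ν) := Real.Gamma_pos_of_pos (by linarith)
  by_contra! hlt
  rw [lt_div_iff₀ hΓ] at hlt
  -- `K'` is the derivative of `∫_0^σ (σ - s)^(-ν) (p t₁ - p s) ds`; it is positive near `t₁`.
  set K' : ℝ → ℝ := fun σ => (p t₁ - p 0) * σ ^ (-ν) - q σ * Real.Gamma (1 - ν) with hK'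
  have hK'lim : Tendsto K' (𝓝[<] t₁) (𝓝 (K' t₁)) := by
    refine ContinuousWithinAt.sub ?_ (hq.mul continuousWithinAt_const)
    exact (continuousAt_const.mul (continuousAt_id.rpow_const
      (Or.inl ht₁.ne'))).continuousWithinAt
  have hev : ∀ᶠ σ in 𝓝[<] t₁, 0 < K' σ := hK'lim.eventually (lt_mem_nhds (by
    simp only [hK']; linarith))
  obtain ⟨a', ha't, ha'⟩ := (mem_nhdsLT_iff_exists_Ioo_subset).1 hev
  -- The gap to the maximum, extended to a bounded continuous function on the line.
  set ψ : ℝ → ℝ := IccExtend ht₁.le ((Icc 0 t₁).domRestrict fun s => p t₁ - p s) with hψ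
  have hψc : Continuous ψ :=
    Continuous.Icc_extend' (continuousOn_iff_continuous_domRestrict.1 (continuousOn_const.sub hp))
  have hψeq : ∀ s ∈ Icc 0 t₁, ψ s = p t₁ - p s := fun s hs => by
    rw [hψ, IccExtend_of_mem _ _ hs, domRestrict_apply]
  have hψ₀ : ∀ s, 0 ≤ ψ s := fun s => by
    simp only [hψ, IccExtend, Function.comp, domRestrict_apply]
    linarith [hmax _ (projIcc 0 t₁ ht₁.le s).2]
  obtain ⟨C, hC⟩ : ∃ C, ∀ s, |ψ s| ≤ C := by
    obtain ⟨C, hC⟩ := isCompact_Icc.exists_bound_of_continuousOn (s := Icc 0 t₁)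
      (f := fun s => p t₁ - p s) (continuousOn_const.sub hp)
    exact ⟨C, fun s => hC _ (projIcc 0 t₁ ht₁.le s).2⟩
  refine not_strictly_increasing_kernelIntegral (a := max a' (t₁ / 2)) (K' := K') hν₀ hν₁
    (lt_max_of_lt_right (by linarith)) (max_lt ha't (by linarith)) hψc hC hψ₀
    (by rw [hψeq _ ⟨ht₁.le, le_rfl⟩, sub_self]) (fun σ hσ => ?_)
    fun σ hσ => ha' ⟨(le_max_left _ _).trans_lt hσ.1, hσ.2⟩
  have h1 : HasDerivAt (fun σ : ℝ => (p t₁ - p 0) * (σ ^ (1 - ν) / (1 - ν)))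
      ((p t₁ - p 0) * σ ^ (-ν)) σ := by
    refine (((Real.hasDerivAt_rpow_const (p := 1 - ν) (Or.inl hσ.1.ne')).div_const
      (1 - ν)).const_mul (p t₁ - p 0)).congr_deriv ?_
    rw [show 1 - ν - 1 = -ν by ring, mul_div_cancel_left₀ _ (by linarith : 1 - ν ≠ 0)]
  refine (h1.sub ((hder σ hσ).mul_const (Real.Gamma (1 - ν)))).congr_of_eventuallyEq ?_
  filter_upwards [isOpen_Ioo.mem_nhds hσ] with r hr
  have hpr : ContinuousOn (fun s => p s - p 0) (Icc 0 r) :=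
    (hp.mono (Icc_subset_Icc_right hr.2.le)).sub continuousOn_const
  simp only [Pi.sub_apply]
  rw [fracIntegral_one_sub, mul_comm (Real.Gamma (1 - ν))⁻¹, inv_mul_cancel_right₀ hΓ.ne',
    ← integral_sub_rpow_neg hν₁, ← intervalIntegral.integral_const_mul,
    ← intervalIntegral.integral_sub
      ((intervalIntegrable_sub_rpow_neg hν₁ r 0 r).const_mul _)
      (intervalIntegrable_kernel_mul hν₁ hr.1.le hpr)]
  refine intervalIntegral.integral_congr fun s hs => ?_
  rw [uIcc_of_le hr.1.le] at hs
  rw [hψeq s ⟨hs.1, hs.2.trans hr.2.le⟩]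
  ring

/-! ### The Mittag-Leffler function -/

/-- The part of the Gamma integral over `(R, ∞)`. As `R` is arbitrary, `Γ` grows faster than every
exponential. -/
theorem rpow_mul_exp_neg_le_Gamma {R s : ℝ} (hR : 0 < R) (hs : 1 ≤ s) :
    R ^ (s - 1) * Real.exp (-R) ≤ Real.Gamma s := by
  have hs0 : 0 < s := by linarith
  have hint := Real.GammaIntegral_convergent hs0
  rw [Real.Gamma_eq_integral hs0]
  calc R ^ (s - 1) * Real.exp (-R) = ∫ x in Ioi R, Real.exp (-x) * R ^ (s - 1) := by
        rw [integral_mul_const, integral_exp_neg_Ioi, mul_comm]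
    _ ≤ ∫ x in Ioi R, Real.exp (-x) * x ^ (s - 1) := by
        refine setIntegral_mono_on ((integrableOn_exp_neg_Ioi R).mul_const _)
          (hint.mono_set (Ioi_subset_Ioi hR.le)) measurableSet_Ioi fun x hx => ?_
        have : R < x := hx
        gcongr
    _ ≤ ∫ x in Ioi 0, Real.exp (-x) * x ^ (s - 1) := by
        refine setIntegral_mono_set hint ?_ (Ioi_subset_Ioi hR.le).eventuallyLE
        refine (ae_restrict_iff' measurableSet_Ioi).2 (Eventually.of_forall fun x hx => ?_)
        have : 0 < x := hx
        simp only [Pi.zero_apply]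
        positivity

theorem Gamma_mittagLeffler_pos {ν : ℝ} (hν₀ : 0 < ν) (k : ℕ) : 0 < Real.Gamma (ν * k + 1) :=
  Real.Gamma_pos_of_pos (by positivity)

theorem summable_mittagLeffler {ν : ℝ} (hν₀ : 0 < ν) (x : ℝ) :
    Summable fun k : ℕ => x ^ k / Real.Gamma (ν * k + 1) := by
  -- With this `R`, the terms are dominated by a geometric series of ratio below `1 / 2`.
  set R : ℝ := (2 * |x| + 1) ^ ν⁻¹ with hR
  have hR0 : 0 < R := by positivity
  have hRν : R ^ ν = 2 * |x| + 1 := by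
    rw [hR, ← Real.rpow_mul (by positivity), inv_mul_cancel₀ hν₀.ne', Real.rpow_one]
  have hq : |x| / R ^ ν < 1 := by
    rw [hRν, div_lt_one (by positivity)]
    linarith [abs_nonneg x]
  refine Summable.of_norm_bounded
    ((summable_geometric_of_lt_one (by positivity) hq).mul_left (Real.exp R)) fun k => ?_
  have hΓ := rpow_mul_exp_neg_le_Gamma (s := ν * k + 1) hR0 (by
    have : 0 ≤ ν * k := by positivity
    linarith)
  rw [norm_div, norm_pow, Real.norm_eq_abs, Real.norm_of_nonneg (Gamma_mittagLeffler_pos hν₀ k).le]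
  calc |x| ^ k / Real.Gamma (ν * k + 1)
      ≤ |x| ^ k / (R ^ (ν * k + 1 - 1) * Real.exp (-R)) := by gcongr
    _ = Real.exp R * (|x| / R ^ ν) ^ k := by
        rw [add_sub_cancel_right, Real.rpow_mul hR0.le, Real.rpow_natCast, Real.exp_neg, div_pow]
        field_simp

theorem abs_mittagLeffler_term_le {ν x r : ℝ} (hν₀ : 0 < ν) (hx : |x| ≤ r) (k : ℕ) :
    |x ^ k / Real.Gamma (ν * k + 1)| ≤ r ^ k / Real.Gamma (ν * k + 1) := by
  have := Gamma_mittagLeffler_pos hν₀ k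
  rw [abs_div, abs_pow, abs_of_pos this]
  gcongr

theorem continuous_mittagLeffler {ν : ℝ} (hν₀ : 0 < ν) : Continuous (mittagLeffler ν 1) := by
  refine continuous_iff_continuousAt.2 fun x => ?_
  have h : ContinuousOn (mittagLeffler ν 1) (Icc (-(|x| + 1)) (|x| + 1)) :=
    continuousOn_tsum (fun k => by fun_prop) (summable_mittagLeffler hν₀ (|x| + 1))
      fun k y hy => abs_mittagLeffler_term_le hν₀ (abs_le.2 hy) k
  exact h.continuousAt (Icc_mem_nhds (by linarith [neg_abs_le x]) (by linarith [le_abs_self x]))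

theorem mittagLeffler_zero (ν : ℝ) : mittagLeffler ν 1 0 = 1 := by
  rw [mittagLeffler, tsum_eq_single 0 (fun k hk => by simp [hk])]
  simp

theorem one_le_mittagLeffler {ν x : ℝ} (hν₀ : 0 < ν) (hx : 0 ≤ x) : 1 ≤ mittagLeffler ν 1 x := by
  have h := (summable_mittagLeffler hν₀ x).le_tsum 0 fun k _ => by
    have := Gamma_mittagLeffler_pos hν₀ k
    positivity
  simpa [mittagLeffler] using h

theorem continuous_mittagLeffler_rpow {ν : ℝ} (hν₀ : 0 < ν) (l : ℝ) :
    Continuous fun t : ℝ => mittagLeffler ν 1 (l * t ^ ν) :=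
  (continuous_mittagLeffler hν₀).comp
    (continuous_const.mul (Real.continuous_rpow_const hν₀.le))

/-- The Beta integral over `[0, t]`. -/
theorem integral_sub_rpow_neg_mul_rpow {ν β t : ℝ} (hν₁ : ν < 1) (hβ : -1 < β) (ht : 0 < t) :
    ∫ s in (0 : ℝ)..t, (t - s) ^ (-ν) * s ^ β =
      t ^ (β + 1 - ν) * (Real.Gamma (1 - ν) * Real.Gamma (β + 1) / Real.Gamma (β + 2 - ν)) := by
  have h := Complex.betaIntegral_scaled ((β + 1 : ℝ) : ℂ) ((1 - ν : ℝ) : ℂ) ht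
  rw [Complex.betaIntegral_eq_Gamma_mul_div _ _ (by simp; linarith) (by simp; linarith)] at h
  have e1 : ∫ x in (0 : ℝ)..t, (x : ℂ) ^ (((β + 1 : ℝ) : ℂ) - 1) *
      ((t : ℂ) - x) ^ (((1 - ν : ℝ) : ℂ) - 1) =
      ((∫ s in (0 : ℝ)..t, (t - s) ^ (-ν) * s ^ β : ℝ) : ℂ) := by
    rw [← intervalIntegral.integral_ofReal]
    refine intervalIntegral.integral_congr fun s hs => ?_
    rw [uIcc_of_le ht.le] at hs
    rw [Complex.ofReal_mul, Complex.ofReal_cpow hs.1, Complex.ofReal_cpow (by linarith [hs.2])]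
    push_cast
    rw [mul_comm]
    congr 2 <;> ring
  rw [e1] at h
  apply Complex.ofReal_injective
  rw [h, Complex.ofReal_mul, Complex.ofReal_div, Complex.ofReal_mul,
    Complex.ofReal_cpow ht.le, Complex.Gamma_ofReal, Complex.Gamma_ofReal, ← Complex.ofReal_add,
    Complex.Gamma_ofReal, show β + 1 + (1 - ν) = β + 2 - ν by ring]
  push_cast
  rw [mul_comm (Real.Gamma (β + 1) : ℂ)]
  congr 2
  ring

/-- Termwise integration of a normally convergent series against an integrable kernel. -/
theorem hasSum_integral_kernel_mul {t : ℝ} {κ : ℝ → ℝ} (hκ : IntervalIntegrable κ volume 0 t)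
    {g : ℕ → ℝ → ℝ} {u : ℕ → ℝ} (hg : ∀ k, Continuous (g k)) (hu : Summable u)
    (hgu : ∀ k, ∀ s ∈ uIoc 0 t, |g k s| ≤ u k) :
    HasSum (fun k => ∫ s in (0 : ℝ)..t, κ s * g k s)
      (∫ s in (0 : ℝ)..t, κ s * ∑' k, g k s) := by
  refine intervalIntegral.hasSum_integral_of_dominated_convergence (fun k s => |κ s| * u k)
    (fun k => (intervalIntegrable_iff.1 hκ).aestronglyMeasurable.mul (hg k).aestronglyMeasurable)
    (fun k => Eventually.of_forall fun s hs => ?_)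
    (Eventually.of_forall fun s _ => hu.mul_left _) ?_ (Eventually.of_forall fun s hs => ?_)
  · rw [norm_mul, Real.norm_eq_abs, Real.norm_eq_abs]
    exact mul_le_mul_of_nonneg_left (hgu k s hs) (abs_nonneg _)
  · have h := hκ.abs.mul_const (∑' k, u k)
    simpa only [tsum_mul_left] using h
  · have h : Summable fun k => g k s := Summable.of_norm_bounded hu fun k => hgu k s hs
    exact h.hasSum.mul_left (κ s)

/-- The integrated form of `D^ν E_{ν,1}(l t^ν) = l E_{ν,1}(l t^ν)`, by comparison of the two series
term by term. -/
theorem fracIntegral_mittagLeffler {ν l t : ℝ} (hν₀ : 0 < ν) (hν₁ : ν < 1) (ht : 0 < t) :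
    fracIntegral (1 - ν)
      (fun s => mittagLeffler ν 1 (l * s ^ ν) - mittagLeffler ν 1 (l * 0 ^ ν)) t =
    ∫ s in (0 : ℝ)..t, l * mittagLeffler ν 1 (l * s ^ ν) := by
  have hΓ1 : 0 < Real.Gamma (1 - ν) := Real.Gamma_pos_of_pos (by linarith)
  have hcr : Continuous fun s : ℝ => s ^ ν := Real.continuous_rpow_const hν₀.le
  have hbound : ∀ s ∈ uIoc 0 t, |l * s ^ ν| ≤ |l| * t ^ ν := fun s hs => by
    rw [uIoc_of_le ht.le] at hs
    have := hs.1
    rw [abs_mul, abs_of_nonneg (a := s ^ ν) (by positivity)]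
    exact mul_le_mul_of_nonneg_left (Real.rpow_le_rpow hs.1.le hs.2 hν₀.le) (abs_nonneg l)
  have hR := hasSum_integral_kernel_mul (t := t) (κ := fun _ => l)
    (g := fun k s => (l * s ^ ν) ^ k / Real.Gamma (ν * k + 1))
    intervalIntegrable_const (fun k => by fun_prop) (summable_mittagLeffler hν₀ (|l| * t ^ ν))
    fun k s hs => abs_mittagLeffler_term_le hν₀ (hbound s hs) k
  have hL := (hasSum_integral_kernel_mul (t := t) (κ := fun s => (t - s) ^ (-ν))
    (g := fun k s => (l * s ^ ν) ^ (k + 1) / Real.Gamma (ν * ↑(k + 1) + 1))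
    (intervalIntegrable_sub_rpow_neg hν₁ t 0 t) (fun k => by fun_prop)
    ((summable_nat_add_iff 1).2 (summable_mittagLeffler hν₀ (|l| * t ^ ν)))
    fun k s hs => abs_mittagLeffler_term_le hν₀ (hbound s hs) (k + 1)).mul_left
    (Real.Gamma (1 - ν))⁻¹
  have hshift : ∀ s : ℝ, mittagLeffler ν 1 (l * s ^ ν) - mittagLeffler ν 1 (l * 0 ^ ν) =
      ∑' k : ℕ, (l * s ^ ν) ^ (k + 1) / Real.Gamma (ν * ↑(k + 1) + 1) := fun s => by
    rw [Real.zero_rpow hν₀.ne', mul_zero, mittagLeffler_zero, mittagLeffler,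
      (summable_mittagLeffler hν₀ (l * s ^ ν)).tsum_eq_zero_add]
    simp
  simp only [fracIntegral_one_sub, hshift]
  refine hL.unique ?_
  convert! hR using 1
  funext k
  have hk : 0 < ν * k + 1 := by positivity
  have hΓk := Gamma_mittagLeffler_pos hν₀ k
  have hΓk' := Gamma_mittagLeffler_pos hν₀ (k + 1)
  have hpow : ∀ s ∈ Icc 0 t, ∀ j : ℕ, (l * s ^ ν) ^ j = l ^ j * s ^ (ν * j) := fun s hs j => by
    rw [mul_pow, ← Real.rpow_mul_natCast hs.1]
  have e1 : ∫ s in (0 : ℝ)..t,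
      (t - s) ^ (-ν) * ((l * s ^ ν) ^ (k + 1) / Real.Gamma (ν * ↑(k + 1) + 1)) =
      l ^ (k + 1) / Real.Gamma (ν * ↑(k + 1) + 1) *
        ∫ s in (0 : ℝ)..t, (t - s) ^ (-ν) * s ^ (ν * ↑(k + 1)) := by
    rw [← intervalIntegral.integral_const_mul]
    refine intervalIntegral.integral_congr fun s hs => ?_
    rw [uIcc_of_le ht.le] at hs
    rw [hpow s hs]
    ring
  have e2 : ∫ s in (0 : ℝ)..t, l * ((l * s ^ ν) ^ k / Real.Gamma (ν * k + 1)) =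
      l ^ (k + 1) / Real.Gamma (ν * k + 1) * ∫ s in (0 : ℝ)..t, s ^ (ν * k) := by
    rw [← intervalIntegral.integral_const_mul]
    refine intervalIntegral.integral_congr fun s hs => ?_
    rw [uIcc_of_le ht.le] at hs
    rw [hpow s hs]
    ring
  have hνk : 0 ≤ ν * k := by positivity
  have hνk1 : 0 ≤ ν * ↑(k + 1) := by positivity
  rw [e1, e2, integral_sub_rpow_neg_mul_rpow hν₁ (by linarith) ht,
    integral_rpow (Or.inl (by linarith)), Real.zero_rpow hk.ne', sub_zero]
  have e3 : ν * ↑(k + 1) + 1 - ν = ν * k + 1 := by push_cast; ring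
  have e4 : ν * ↑(k + 1) + 2 - ν = ν * k + 1 + 1 := by push_cast; ring
  rw [e3, e4, Real.Gamma_add_one hk.ne']
  field_simp

theorem hasCaputoDerivAt_mittagLeffler {ν t : ℝ} (hν₀ : 0 < ν) (hν₁ : ν < 1) (ht : 0 < t)
    (l : ℝ) : HasCaputoDerivAt ν (fun s => mittagLeffler ν 1 (l * s ^ ν))
      (l * mittagLeffler ν 1 (l * t ^ ν)) t := by
  have hc : Continuous fun s : ℝ => l * mittagLeffler ν 1 (l * s ^ ν) :=
    continuous_const.mul (continuous_mittagLeffler_rpow hν₀ l)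
  refine (intervalIntegral.integral_hasDerivAt_right (hc.intervalIntegrable 0 t)
    hc.stronglyMeasurable.stronglyMeasurableAtFilter hc.continuousAt).congr_of_eventuallyEq ?_
  filter_upwards [lt_mem_nhds ht] with r hr
  exact fracIntegral_mittagLeffler hν₀ hν₁ hr

/-- For `x < 0`, if `E_{ν,1}(x) ≤ 0`, the maximum of `p(t) = -E_{ν,1}(x t^ν)` over `[0, 1]` is
nonnegative, so its Caputo derivative `x p` is nonpositive there, but `p(0) = -1` makes the bound of
the maximum principle strictly positive. -/
theorem mittagLeffler_pos {ν : ℝ} (hν₀ : 0 < ν) (hν₁ : ν < 1) (x : ℝ) :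
    0 < mittagLeffler ν 1 x := by
  rcases le_or_gt 0 x with hx | hx
  · exact zero_lt_one.trans_le (one_le_mittagLeffler hν₀ hx)
  by_contra! hneg
  set p : ℝ → ℝ := fun t => -1 * mittagLeffler ν 1 (x * t ^ ν) with hp
  have hpc : Continuous p := continuous_const.mul (continuous_mittagLeffler_rpow hν₀ x)
  have hp0 : p 0 = -1 := by simp [hp, Real.zero_rpow hν₀.ne', mittagLeffler_zero]
  have hp1 : 0 ≤ p 1 := by simpa [hp] using hneg
  obtain ⟨t₁, ht₁, hmax⟩ := isCompact_Icc.exists_isMaxOn (nonempty_Icc.2 zero_le_one)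
    (hpc.continuousOn (s := Icc 0 1))
  have hpt : 0 ≤ p t₁ := hp1.trans (hmax (right_mem_Icc.2 zero_le_one))
  have ht₀ : 0 < t₁ := lt_of_le_of_ne ht₁.1 fun h => by rw [← h, hp0] at hpt; linarith
  have h := caputoDeriv_ge_of_isMax (q := fun t => x * p t) hν₀ hν₁ ht₀ hpc.continuousOn
    (continuous_const.mul hpc).continuousWithinAt
    (fun t ht => by
      have := (hasCaputoDerivAt_mittagLeffler hν₀ hν₁ ht.1 x).const_mul (-1)
      rwa [mul_left_comm] at this)
    fun s hs => hmax ⟨hs.1, hs.2.trans ht₁.2⟩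
  have hΓ : 0 < Real.Gamma (1 - ν) := Real.Gamma_pos_of_pos (by linarith)
  have h2 : 0 < (p t₁ - p 0) * t₁ ^ (-ν) / Real.Gamma (1 - ν) := by
    have : 0 < p t₁ - p 0 := by rw [hp0]; linarith
    positivity
  have h3 : x * p t₁ ≤ 0 := mul_nonpos_of_nonpos_of_nonneg hx.le hpt
  linarith

/-! ### Comparison of solutions with Mittag-Leffler barriers -/

/-- A finite family that starts negative and does not stay so has a first time at which one member
vanishes. -/
theorem exists_first_zero {ι : Type*} [Finite ι] {T : ℝ} {g : ι → ℝ → ℝ}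
    (hg : ∀ i, ContinuousOn (g i) (Icc 0 T)) (h0 : ∀ i, g i 0 < 0)
    (hex : ∃ i, ∃ t ∈ Icc 0 T, 0 ≤ g i t) :
    ∃ t₁ ∈ Ioc 0 T, (∃ i, g i t₁ = 0) ∧ ∀ i, ∀ s ∈ Icc 0 t₁, g i s ≤ 0 := by
  have hcomp : IsCompact (⋃ i, (Icc 0 T ∩ g i ⁻¹' Ici 0)) :=
    isCompact_iUnion fun i => isCompact_Icc.of_isClosed_subset
      ((hg i).preimage_isClosed_of_isClosed isClosed_Icc isClosed_Ici) inter_subset_left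
  obtain ⟨i₀, t₀, ht₀, hi₀⟩ := hex
  obtain ⟨t₁, ht₁mem, ht₁min⟩ := hcomp.exists_isLeast ⟨t₀, mem_iUnion.2 ⟨i₀, ht₀, hi₀⟩⟩
  obtain ⟨i, ht₁, hi⟩ := mem_iUnion.1 ht₁mem
  have hi' : 0 ≤ g i t₁ := hi
  have hpos : 0 < t₁ := lt_of_le_of_ne ht₁.1 fun h => by
    rw [← h] at hi'
    linarith [h0 i]
  have hlt : ∀ j, ∀ s ∈ Ico 0 t₁, g j s < 0 := fun j s hs => by
    by_contra! hjs
    exact absurd (ht₁min (mem_iUnion.2 ⟨j, ⟨hs.1, hs.2.le.trans ht₁.2⟩, hjs⟩)) (not_le.2 hs.2)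
  have hle : ∀ j, g j t₁ ≤ 0 := fun j => by
    have hc : Tendsto (g j) (𝓝[Ico 0 t₁] t₁) (𝓝 (g j t₁)) :=
      ((hg j) t₁ ht₁).mono fun s hs => ⟨hs.1, hs.2.le.trans ht₁.2⟩
    have : (𝓝[Ico 0 t₁] t₁).NeBot := right_nhdsWithin_Ico_neBot hpos
    exact le_of_tendsto hc (eventually_mem_nhdsWithin.mono fun s hs => (hlt j s hs).le)
  refine ⟨t₁, ⟨hpos, ht₁.2⟩, ⟨i, le_antisymm (hle i) hi'⟩, fun j s hs => ?_⟩
  rcases hs.2.eq_or_lt with h | h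
  · rw [h]
    exact hle j
  · exact (hlt j s ⟨hs.1, h⟩).le

theorem zero_le_caputoDeriv_of_isMax {ν t₁ : ℝ} (hν₀ : 0 < ν) (hν₁ : ν < 1) (ht₁ : 0 < t₁)
    {p q : ℝ → ℝ} (hp : ContinuousOn p (Icc 0 t₁)) (hq : ContinuousOn q (Icc 0 t₁))
    (hder : ∀ t ∈ Ioo 0 t₁, HasCaputoDerivAt ν p (q t) t)
    (hmax : ∀ s ∈ Icc 0 t₁, p s ≤ p t₁) : 0 ≤ q t₁ := by
  have hq' : ContinuousWithinAt q (Iio t₁) t₁ :=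
    ((hq t₁ ⟨ht₁.le, le_rfl⟩).mono Ioo_subset_Icc_self).mono_of_mem_nhdsWithin
      (Ioo_mem_nhdsLT ht₁)
  refine le_trans ?_ (caputoDeriv_ge_of_isMax hν₀ hν₁ ht₁ hp hq' hder hmax)
  have hΓ : 0 < Real.Gamma (1 - ν) := Real.Gamma_pos_of_pos (by linarith)
  have := sub_nonneg.2 (hmax 0 ⟨le_rfl, ht₁.le⟩)
  positivity

theorem abs_sub_max_min_le {m M x w : ℝ} (hmM : m ≤ M) (hw : 0 ≤ w) (h₁ : m - w ≤ x)
    (h₂ : x ≤ M + w) : |x - max m (min M x)| ≤ w := by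
  rw [abs_le]
  rcases le_total M x with h | h
  · rw [min_eq_left h, max_eq_right hmM]
    constructor <;> linarith
  · rw [min_eq_right h]
    rcases le_total m x with h' | h'
    · rw [max_eq_right h']
      constructor <;> linarith
    · rw [max_eq_left h']
      constructor <;> linarith

/-- The bounds on `f` hold only on the box `[m, M]`. At a first contact with the barrier, the point
`x` of the box nearest to `z` is at distance at most `ε E_{ν,1}(N t^ν)`, and the growth rate `N` of
the barrier dominates the error made by replacing `z` by `x`. -/
theorem IsCaputoSolution.bounds_of_barrier {n : ℕ} {ν T : ℝ} (hν₀ : 0 < ν) (hν₁ : ν < 1)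
    {f : (Fin n → ℝ) → Fin n → ℝ} (hf : Continuous f) {m M a b : Fin n → ℝ} (hmM : m ≤ M)
    (hab : ∀ x ∈ Icc m M, ∀ i, ∀ r ∈ Icc (m i) (M i), a i * r ≤ f x i ∧ f x i ≤ b i * r)
    {z : ℝ → Fin n → ℝ} (hz : IsCaputoSolution ν T f z)
    (hma : ∀ i, ∀ t ∈ Icc 0 T, m i ≤ mittagLeffler ν 1 (a i * t ^ ν) * z 0 i)
    (hMb : ∀ i, ∀ t ∈ Icc 0 T, mittagLeffler ν 1 (b i * t ^ ν) * z 0 i ≤ M i)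
    {K N ε : ℝ} (hK : ∀ t ∈ Icc 0 T, ∀ x ∈ Icc m M, ∀ i, |f (z t) i - f x i| ≤ K * dist (z t) x)
    (hK₀ : 0 ≤ K) (hNa : ∀ i, 2 * |a i| + K < N) (hNb : ∀ i, 2 * |b i| + K < N)
    (hε : 0 < ε) {t : ℝ} (ht : t ∈ Icc 0 T) (i : Fin n) :
    mittagLeffler ν 1 (a i * t ^ ν) * z 0 i - ε * mittagLeffler ν 1 (N * t ^ ν) ≤ z t i ∧
      z t i ≤ mittagLeffler ν 1 (b i * t ^ ν) * z 0 i + ε * mittagLeffler ν 1 (N * t ^ ν) := by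
  have hzc : ∀ i, ContinuousOn (fun s => z s i) (Icc 0 T) := fun i =>
    (continuousOn_pi.1 hz.1) i
  have hfc : ∀ i, ContinuousOn (fun s => f (z s) i) (Icc 0 T) := fun i =>
    (continuousOn_pi.1 (hf.comp_continuousOn hz.1)) i
  set u : ℝ → ℝ → ℝ → ℝ := fun l c s => c * mittagLeffler ν 1 (l * s ^ ν) with hu
  have huc : ∀ l c, Continuous (u l c) := fun l c =>
    continuous_const.mul (continuous_mittagLeffler_rpow hν₀ l)
  have hud : ∀ l c s, 0 < s → HasCaputoDerivAt ν (u l c) (l * u l c s) s := fun l c s hs => by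
    have := (hasCaputoDerivAt_mittagLeffler hν₀ hν₁ hs l).const_mul c
    rwa [mul_left_comm] at this
  have hu0 : ∀ l c, u l c 0 = c := fun l c => by
    simp [hu, Real.zero_rpow hν₀.ne', mittagLeffler_zero]
  have hW : ∀ s, 0 ≤ s → 0 < u N ε s := fun s hs =>
    mul_pos hε (mittagLeffler_pos hν₀ hν₁ _)
  set p₁ : Fin n → ℝ → ℝ := fun i s => z s i - u (b i) (z 0 i) s - u N ε s with hp₁
  set p₂ : Fin n → ℝ → ℝ := fun i s => u (a i) (z 0 i) s - z s i - u N ε s with hp₂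
  have hp₁c : ∀ i, ContinuousOn (p₁ i) (Icc 0 T) := fun i =>
    ((hzc i).sub (huc _ _).continuousOn).sub (huc _ _).continuousOn
  have hp₂c : ∀ i, ContinuousOn (p₂ i) (Icc 0 T) := fun i =>
    ((huc _ _).continuousOn.sub (hzc i)).sub (huc _ _).continuousOn
  by_contra hcon
  obtain ⟨t₁, ht₁, ⟨j, hj⟩, hle⟩ := exists_first_zero
    (g := fun i s => max (p₁ i s) (p₂ i s)) (fun i => (hp₁c i).sup (hp₂c i))
    (fun i => by simp [hp₁, hp₂, hu0, hε])
    ⟨i, t, ht, by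
      by_contra! hneg
      obtain ⟨h1, h2⟩ := max_lt_iff.1 hneg
      apply hcon
      simp only [hp₁, hp₂, hu] at h1 h2
      constructor <;> linarith [mul_comm (z 0 i) (mittagLeffler ν 1 (a i * t ^ ν)),
        mul_comm (z 0 i) (mittagLeffler ν 1 (b i * t ^ ν))]⟩
  have hsub : Icc 0 t₁ ⊆ Icc 0 T := Icc_subset_Icc_right ht₁.2
  have ht₁' : t₁ ∈ Icc 0 T := ⟨ht₁.1.le, ht₁.2⟩
  have hle₁ : ∀ i, ∀ s ∈ Icc 0 t₁, p₁ i s ≤ 0 := fun i s hs =>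
    (le_max_left _ _).trans (hle i s hs)
  have hle₂ : ∀ i, ∀ s ∈ Icc 0 t₁, p₂ i s ≤ 0 := fun i s hs =>
    (le_max_right _ _).trans (hle i s hs)
  set w : ℝ := u N ε t₁ with hw
  have hw0 : 0 < w := hW t₁ ht₁.1.le
  -- The point of the box nearest to `z t₁`.
  set x : Fin n → ℝ := fun i => max (m i) (min (M i) (z t₁ i)) with hx
  have hxmem : x ∈ Icc m M :=
    ⟨fun i => le_max_left _ _, fun i => max_le (hmM i) (min_le_left _ _)⟩
  have habs : ∀ i, |z t₁ i - x i| ≤ w := fun i => by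
    have h1 := hle₁ i t₁ ⟨ht₁.1.le, le_rfl⟩
    have h2 := hle₂ i t₁ ⟨ht₁.1.le, le_rfl⟩
    have h3 := hma i t₁ ht₁'
    have h4 := hMb i t₁ ht₁'
    simp only [hp₁, hp₂, ← hw] at h1 h2
    rw [mul_comm] at h3 h4
    refine abs_sub_max_min_le (hmM i) hw0.le ?_ ?_
    · linarith [show m i ≤ u (a i) (z 0 i) t₁ from h3]
    · linarith [show u (b i) (z 0 i) t₁ ≤ M i from h4]
  have hdist : dist (z t₁) x ≤ w := (dist_pi_le_iff hw0.le).2 habs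
  have hfx : |f (z t₁) j - f x j| ≤ K * w :=
    (hK t₁ ht₁' x hxmem j).trans (mul_le_mul_of_nonneg_left hdist hK₀)
  have hxj : x j ∈ Icc (m j) (M j) := ⟨hxmem.1 j, hxmem.2 j⟩
  obtain ⟨hlo, hhi⟩ := hab x hxmem j (x j) hxj
  have hmulb : ∀ l : ℝ, |l * (z t₁ j - x j)| ≤ |l| * w := fun l => by
    rw [abs_mul]
    exact mul_le_mul_of_nonneg_left (habs j) (abs_nonneg l)
  have hder : ∀ s ∈ Ioo 0 t₁, HasCaputoDerivAt ν (fun s => z s j) (f (z s) j) s :=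
    fun s hs => hz.2 s ⟨hs.1, hs.2.trans_le ht₁.2⟩ j
  -- At the contact, the Caputo derivative of the touching difference is negative.
  rcases max_choice (p₁ j t₁) (p₂ j t₁) with hc | hc
  · rw [hc] at hj
    have hq := zero_le_caputoDeriv_of_isMax
      (q := fun s => f (z s) j - b j * u (b j) (z 0 j) s - N * u N ε s) hν₀ hν₁ ht₁.1
      ((hp₁c j).mono hsub)
      ((((hfc j).mono hsub).sub (continuous_const.mul (huc _ _)).continuousOn).sub
        (continuous_const.mul (huc _ _)).continuousOn)
      (fun s hs => ((hder s hs).sub hν₁ ((hzc j).mono hsub) (huc _ _).continuousOn hs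
        (hud _ _ s hs.1)).sub hν₁ (((hzc j).mono hsub).sub (huc _ _).continuousOn)
        (huc _ _).continuousOn hs (hud _ _ s hs.1))
      fun s hs => (hle₁ j s hs).trans hj.ge
    simp only [← hw] at hq
    have hzj : u (b j) (z 0 j) t₁ = z t₁ j - w := by
      simp only [hp₁, ← hw] at hj
      linarith
    rw [hzj] at hq
    have h1 := (abs_le.1 hfx).2
    have h2 := (abs_le.1 (hmulb (b j))).1
    have h3 := mul_lt_mul_of_pos_right (hNb j) hw0
    have h4 := mul_le_mul_of_nonneg_right (le_abs_self (b j)) hw0.le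
    linarith
  · rw [hc] at hj
    have hq := zero_le_caputoDeriv_of_isMax
      (q := fun s => a j * u (a j) (z 0 j) s - f (z s) j - N * u N ε s) hν₀ hν₁ ht₁.1
      ((hp₂c j).mono hsub)
      (((continuous_const.mul (huc _ _)).continuousOn.sub ((hfc j).mono hsub)).sub
        (continuous_const.mul (huc _ _)).continuousOn)
      (fun s hs => ((hud _ _ s hs.1).sub hν₁ (huc _ _).continuousOn ((hzc j).mono hsub) hs
        (hder s hs)).sub hν₁ ((huc _ _).continuousOn.sub ((hzc j).mono hsub))
        (huc _ _).continuousOn hs (hud _ _ s hs.1))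
      fun s hs => (hle₂ j s hs).trans hj.ge
    simp only [← hw] at hq
    have hzj : u (a j) (z 0 j) t₁ = z t₁ j + w := by
      simp only [hp₂, ← hw] at hj
      linarith
    rw [hzj] at hq
    have h1 := (abs_le.1 hfx).1
    have h2 := (abs_le.1 (hmulb (a j))).2
    have h3 := mul_lt_mul_of_pos_right (hNa j) hw0
    have h4 := mul_le_mul_of_nonneg_right (le_abs_self (a j)) hw0.le
    linarith

/-- If `a i * r ≤ f x i ≤ b i * r` on a box which contains the Mittag-Leffler functions with rates
`a i` and `b i`, a solution stays between these functions. -/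
theorem IsCaputoSolution.mem_Icc_mittagLeffler {n : ℕ} {ν T : ℝ} (hν₀ : 0 < ν) (hν₁ : ν < 1)
    {f : (Fin n → ℝ) → Fin n → ℝ} (hf : LocallyLipschitz f) {m M a b : Fin n → ℝ} (hmM : m ≤ M)
    (hab : ∀ x ∈ Icc m M, ∀ i, ∀ r ∈ Icc (m i) (M i), a i * r ≤ f x i ∧ f x i ≤ b i * r)
    {z : ℝ → Fin n → ℝ} (hz : IsCaputoSolution ν T f z)
    (hma : ∀ i, ∀ t ∈ Icc 0 T, m i ≤ mittagLeffler ν 1 (a i * t ^ ν) * z 0 i)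
    (hMb : ∀ i, ∀ t ∈ Icc 0 T, mittagLeffler ν 1 (b i * t ^ ν) * z 0 i ≤ M i)
    {t : ℝ} (ht : t ∈ Icc 0 T) (i : Fin n) :
    z t i ∈ Icc (mittagLeffler ν 1 (a i * t ^ ν) * z 0 i)
      (mittagLeffler ν 1 (b i * t ^ ν) * z 0 i) := by
  obtain ⟨K, hK⟩ := LocallyLipschitzOn.exists_lipschitzOnWith_of_compact
    ((isCompact_Icc.image_of_continuousOn hz.1).union (isCompact_Icc (a := m) (b := M)))
    hf.locallyLipschitzOn
  have hK' : ∀ t ∈ Icc 0 T, ∀ x ∈ Icc m M, ∀ i,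
      |f (z t) i - f x i| ≤ K * dist (z t) x := fun t ht x hx i =>
    (dist_le_pi_dist (f (z t)) (f x) i).trans
      (hK.dist_le_mul _ (Or.inl (mem_image_of_mem z ht)) _ (Or.inr hx))
  set N : ℝ := 2 * ‖a‖ + 2 * ‖b‖ + K + 1 with hN
  have hna : ∀ i, |a i| ≤ ‖a‖ := norm_le_pi_norm a
  have hnb : ∀ i, |b i| ≤ ‖b‖ := norm_le_pi_norm b
  have hbar := fun ε (hε : 0 < ε) => hz.bounds_of_barrier hν₀ hν₁ hf.continuous hmM hab hma hMb
    hK' K.2 (N := N) (ε := ε) (fun i => by linarith [hna i, norm_nonneg b])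
    (fun i => by linarith [hnb i, norm_nonneg a])
    hε ht i
  have hE := mittagLeffler_pos hν₀ hν₁ (N * t ^ ν)
  constructor
  · refine le_of_forall_pos_le_add fun δ hδ => ?_
    have := (hbar (δ / mittagLeffler ν 1 (N * t ^ ν)) (by positivity)).1
    rw [div_mul_cancel₀ _ hE.ne'] at this
    linarith
  · refine le_of_forall_pos_le_add fun δ hδ => ?_
    have := (hbar (δ / mittagLeffler ν 1 (N * t ^ ν)) (by positivity)).2
    rwa [div_mul_cancel₀ _ hE.ne'] at this

/-! ### The limit of the interval iteration -/

theorem mem_mlComponent_iff {n : ℕ} {ν : ℝ} {L Z₀ : Fin n → NonemptyInterval ℝ} {τ : Set ℝ}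
    {i : Fin n} {r : ℝ} : r ∈ mlComponent ν L Z₀ τ i ↔
      ∃ l ∈ L i, ∃ t ∈ τ, ∃ y ∈ Z₀ i, mittagLeffler ν 1 (l * t ^ ν) * y = r := by
  simp only [mlComponent, mittagLefflerRange, Set.mem_mul, mem_image2, SetLike.mem_coe]
  constructor
  · rintro ⟨_, ⟨l, hl, t, ht, rfl⟩, y, hy, rfl⟩
    exact ⟨l, hl, t, ht, y, hy, rfl⟩
  · rintro ⟨l, hl, t, ht, y, hy, rfl⟩
    exact ⟨_, ⟨l, hl, t, ht, rfl⟩, y, hy, rfl⟩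

theorem exists_mlComponent_eq_Icc {n : ℕ} {ν T : ℝ} (hν₀ : 0 < ν) (hT : 0 ≤ T)
    (L Z₀ : Fin n → NonemptyInterval ℝ) (i : Fin n) :
    ∃ m M, m ≤ M ∧ mlComponent ν L Z₀ (Icc 0 T) i = Icc m M := by
  have himg : mlComponent ν L Z₀ (Icc 0 T) i =
      (fun x : ℝ × ℝ × ℝ => mittagLeffler ν 1 (x.1 * x.2.1 ^ ν) * x.2.2) ''
        (Icc (L i).fst (L i).snd ×ˢ Icc 0 T ×ˢ Icc (Z₀ i).fst (Z₀ i).snd) := by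
    ext r
    simp only [mem_mlComponent_iff, NonemptyInterval.mem_def, mem_image, mem_prod, Prod.exists,
      mem_Icc]
    constructor
    · rintro ⟨l, hl, t, ht, y, hy, rfl⟩
      exact ⟨l, t, y, ⟨hl, ht, hy⟩, rfl⟩
    · rintro ⟨l, t, y, ⟨hl, ht, hy⟩, rfl⟩
      exact ⟨l, hl, t, ht, y, hy, rfl⟩
  have hcont : Continuous fun x : ℝ × ℝ × ℝ => mittagLeffler ν 1 (x.1 * x.2.1 ^ ν) * x.2.2 := by
    have h1 := continuous_mittagLeffler hν₀
    have h2 : Continuous fun t : ℝ => t ^ ν := Real.continuous_rpow_const hν₀.le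
    fun_prop
  have hcomp : IsCompact (mlComponent ν L Z₀ (Icc 0 T) i) := by
    rw [himg]
    exact (isCompact_Icc.prod (isCompact_Icc.prod isCompact_Icc)).image hcont
  have hconn : IsConnected (mlComponent ν L Z₀ (Icc 0 T) i) := by
    rw [himg]
    exact ((isConnected_Icc (L i).fst_le_snd).prod ((isConnected_Icc hT).prod
      (isConnected_Icc (Z₀ i).fst_le_snd))).image _ hcont.continuousOn
  have h := eq_Icc_of_connected_compact hconn hcomp
  refine ⟨_, _, ?_, h⟩
  rw [h] at hconn
  exact nonempty_Icc.1 hconn.nonempty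

theorem exists_mlEnclosure_eq_Icc {n : ℕ} {ν T : ℝ} (hν₀ : 0 < ν) (hT : 0 ≤ T)
    (L Z₀ : Fin n → NonemptyInterval ℝ) :
    ∃ m M : Fin n → ℝ, m ≤ M ∧ (∀ i, mlComponent ν L Z₀ (Icc 0 T) i = Icc (m i) (M i)) ∧
      mlEnclosure ν L Z₀ (Icc 0 T) = Icc m M := by
  choose m M hmM h using exists_mlComponent_eq_Icc hν₀ hT L Z₀
  refine ⟨m, M, hmM, h, ?_⟩
  ext z
  simp only [mlEnclosure, mem_ofPred_eq, h, mem_Icc, Pi.le_def, forall_and]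

theorem ne_zero_of_mem_mlComponent {n : ℕ} {ν : ℝ} (hν₀ : 0 < ν) (hν₁ : ν < 1)
    {L Z₀ : Fin n → NonemptyInterval ℝ} {τ : Set ℝ} {i : Fin n} (hZ₀ : (0 : ℝ) ∉ Z₀ i) {r : ℝ}
    (hr : r ∈ mlComponent ν L Z₀ τ i) : r ≠ 0 := by
  obtain ⟨l, -, t, -, y, hy, rfl⟩ := mem_mlComponent_iff.1 hr
  exact mul_ne_zero (mittagLeffler_pos hν₀ hν₁ _).ne' fun h => hZ₀ (h ▸ hy)

/-- Every point of the limit interval is a limit of points of the intervals: clamp it to them. -/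
theorem IntervalTendsto.exists_seq {n : ℕ} {L : ℕ → Fin n → NonemptyInterval ℝ}
    {Llim : Fin n → NonemptyInterval ℝ} (hlim : IntervalTendsto L Llim) {i : Fin n} {l : ℝ}
    (hl : l ∈ Llim i) : ∃ l' : ℕ → ℝ, (∀ κ, l' κ ∈ L κ i) ∧ Tendsto l' atTop (𝓝 l) := by
  refine ⟨fun κ => max (L κ i).fst (min (L κ i).snd l), fun κ => ⟨le_max_left _ _,
    max_le (L κ i).fst_le_snd (min_le_left _ _)⟩, ?_⟩
  have h := (hlim i).1.max ((hlim i).2.min (tendsto_const_nhds (x := l)))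
  rwa [min_eq_right hl.2, max_eq_right hl.1] at h

theorem IntervalTendsto.exists_seq_mlComponent {n : ℕ} {ν : ℝ} (hν₀ : 0 < ν)
    {L : ℕ → Fin n → NonemptyInterval ℝ} {Llim Z₀ : Fin n → NonemptyInterval ℝ}
    (hlim : IntervalTendsto L Llim) {τ : Set ℝ} {i : Fin n} {r : ℝ}
    (hr : r ∈ mlComponent ν Llim Z₀ τ i) :
    ∃ r' : ℕ → ℝ, (∀ κ, r' κ ∈ mlComponent ν (L κ) Z₀ τ i) ∧ Tendsto r' atTop (𝓝 r) := by
  obtain ⟨l, hl, t, ht, y, hy, rfl⟩ := mem_mlComponent_iff.1 hr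
  obtain ⟨l', hl', hlim'⟩ := hlim.exists_seq hl
  refine ⟨fun κ => mittagLeffler ν 1 (l' κ * t ^ ν) * y, fun κ =>
    mem_mlComponent_iff.2 ⟨l' κ, hl' κ, t, ht, y, hy, rfl⟩, ?_⟩
  exact (((continuous_mittagLeffler hν₀).tendsto _).comp (hlim'.mul_const _)).mul_const _

/-- The limit intervals contain all quotients `f x i / r` with `x` and `r` in the limit enclosure.
Only the inclusion `f(X) ⊆ F(X)` along the sequence is used, as `F` need not be continuous. -/
theorem div_mem_limit_of_isMLIteration {n : ℕ} {ν T : ℝ} (hν₀ : 0 < ν) (hν₁ : ν < 1)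
    (hT : 0 ≤ T) {f : (Fin n → ℝ) → Fin n → ℝ} (hf : Continuous f)
    {Z₀ : Fin n → NonemptyInterval ℝ} (hZ₀ : ∀ i, (0 : ℝ) ∉ Z₀ i)
    {F : Set (Fin n → ℝ) → Fin n → NonemptyInterval ℝ} (hF : IsIntervalEvaluation f F)
    {L : ℕ → Fin n → NonemptyInterval ℝ} (hL : IsMLIteration ν T F Z₀ L)
    {Llim : Fin n → NonemptyInterval ℝ} (hlim : IntervalTendsto L Llim)
    {x : Fin n → ℝ} (hx : x ∈ mlEnclosure ν Llim Z₀ (Icc 0 T)) {i : Fin n} {r : ℝ}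
    (hr : r ∈ mlComponent ν Llim Z₀ (Icc 0 T) i) : f x i / r ∈ Llim i := by
  obtain ⟨r', hr', hr'lim⟩ := hlim.exists_seq_mlComponent hν₀ hr
  choose x' hx' hx'lim using fun j => hlim.exists_seq_mlComponent hν₀ (hx j)
  have hmem : ∀ κ, f (fun j => x' j κ) i / r' κ ∈ L (κ + 1) i := fun κ => by
    rw [← SetLike.mem_coe, hL κ i]
    refine div_mem_div ?_ (hr' κ)
    obtain ⟨m, M, hmM, -, hEq⟩ := exists_mlEnclosure_eq_Icc (T := T) hν₀ hT (L κ) Z₀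
    have hmemE : (fun j => x' j κ) ∈ mlEnclosure ν (L κ) Z₀ (Icc 0 T) := fun j => hx' j κ
    rw [hEq] at hmemE ⊢
    exact hF m M hmM _ hmemE i
  have hxlim : Tendsto (fun κ j => x' j κ) atTop (𝓝 x) := tendsto_pi_nhds.2 hx'lim
  have hq : Tendsto (fun κ => f (fun j => x' j κ) i / r' κ) atTop (𝓝 (f x i / r)) :=
    (tendsto_pi_nhds.1 ((hf.tendsto x).comp hxlim) i).div hr'lim
      (ne_zero_of_mem_mlComponent hν₀ hν₁ (hZ₀ i) hr)
  exact ⟨le_of_tendsto_of_tendsto' ((hlim i).1.comp (tendsto_add_atTop_nat 1)) hq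
      fun κ => (hmem κ).1,
    le_of_tendsto_of_tendsto' hq ((hlim i).2.comp (tendsto_add_atTop_nat 1))
      fun κ => (hmem κ).2⟩

/-- The endpoints of `[λ_i]` that bound `q * r`, `q ∈ [λ_i]`: lower and upper if the initial
interval is positive, upper and lower if it is negative. -/
theorem exists_endpoints_mul_le {n : ℕ} {ν : ℝ} (hν₀ : 0 < ν) (hν₁ : ν < 1)
    (L : Fin n → NonemptyInterval ℝ) {Z₀ : Fin n → NonemptyInterval ℝ} {τ : Set ℝ} {i : Fin n}
    (hZ₀ : (0 : ℝ) ∉ Z₀ i) : ∃ a ∈ L i, ∃ b ∈ L i, ∀ r ∈ mlComponent ν L Z₀ τ i, ∀ q ∈ L i,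
      a * r ≤ q * r ∧ q * r ≤ b * r := by
  have hfst : (L i).fst ∈ L i := ⟨le_rfl, (L i).fst_le_snd⟩
  have hsnd : (L i).snd ∈ L i := ⟨(L i).fst_le_snd, le_rfl⟩
  rcases lt_or_ge 0 (Z₀ i).fst with h | h
  · refine ⟨_, hfst, _, hsnd, fun r hr q hq => ?_⟩
    obtain ⟨l, -, t, -, y, hy, rfl⟩ := mem_mlComponent_iff.1 hr
    have hr0 := mul_nonneg (mittagLeffler_pos hν₀ hν₁ (l * t ^ ν)).le (h.le.trans hy.1)
    exact ⟨mul_le_mul_of_nonneg_right hq.1 hr0, mul_le_mul_of_nonneg_right hq.2 hr0⟩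
  · have h' : (Z₀ i).snd < 0 := by
      by_contra! h'
      exact hZ₀ ⟨h, h'⟩
    refine ⟨_, hsnd, _, hfst, fun r hr q hq => ?_⟩
    obtain ⟨l, -, t, -, y, hy, rfl⟩ := mem_mlComponent_iff.1 hr
    have hr0 := mul_nonpos_of_nonneg_of_nonpos (mittagLeffler_pos hν₀ hν₁ (l * t ^ ν)).le
      (hy.2.trans h'.le)
    exact ⟨mul_le_mul_of_nonpos_right hq.2 hr0, mul_le_mul_of_nonpos_right hq.1 hr0⟩

theorem mainTheorem3 {n : ℕ} (ν T : ℝ) (hν₀ : 0 < ν) (hν₁ : ν < 1) (hT : 0 < T)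
    (𝒜 : (Fin n → ℝ) → Matrix (Fin n) (Fin n) ℝ)
    (S : Matrix (Fin n) (Fin n) ℝ) (hS : IsUnit S.det)
    (hf : LocallyLipschitz (quasiLinearRHS (transformedMatrix 𝒜 S)))
    (Z₀ : Fin n → NonemptyInterval ℝ) (hZ₀ : ∀ i, (0 : ℝ) ∉ Z₀ i)
    (F : Set (Fin n → ℝ) → Fin n → NonemptyInterval ℝ)
    (hF : IsIntervalEvaluation (quasiLinearRHS (transformedMatrix 𝒜 S)) F)
    (L : ℕ → Fin n → NonemptyInterval ℝ) (hL : IsMLIteration ν T F Z₀ L)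
    (Llim : Fin n → NonemptyInterval ℝ) (hlim : IntervalTendsto L Llim) :
    reachableStates ν T (quasiLinearRHS (transformedMatrix 𝒜 S)) Z₀ ⊆
      mlEnclosure ν Llim Z₀ {T} := by
  rintro _ ⟨z, hz, hz0, rfl⟩ i
  obtain ⟨m, M, hmM, hcomp, hEq⟩ := exists_mlEnclosure_eq_Icc (T := T) hν₀ hT.le Llim Z₀
  choose a ha b hb hab using fun i =>
    exists_endpoints_mul_le (τ := Icc 0 T) hν₀ hν₁ Llim (hZ₀ i)
  have hmem : ∀ i, ∀ l ∈ Llim i, ∀ t ∈ Icc 0 T,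
      mittagLeffler ν 1 (l * t ^ ν) * z 0 i ∈ Icc (m i) (M i) := fun i l hl t ht => by
    rw [← hcomp i]
    exact mem_mlComponent_iff.2 ⟨l, hl, t, ht, z 0 i, hz0 i, rfl⟩
  have hbounds := hz.mem_Icc_mittagLeffler hν₀ hν₁ hf hmM (a := a) (b := b)
    (fun x hx j r hr => by
      rw [← hcomp j] at hr
      rw [← hEq] at hx
      have h := hab j r hr _
        (div_mem_limit_of_isMLIteration hν₀ hν₁ hT.le hf.continuous hZ₀ hF hL hlim hx hr)
      rwa [div_mul_cancel₀ _ (ne_zero_of_mem_mlComponent hν₀ hν₁ (hZ₀ j) hr)] at h)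
    (fun j t ht => (hmem j _ (ha j) t ht).1) (fun j t ht => (hmem j _ (hb j) t ht).2)
    (right_mem_Icc.2 hT.le) i
  have hcont : Continuous fun l => mittagLeffler ν 1 (l * T ^ ν) * z 0 i :=
    ((continuous_mittagLeffler hν₀).comp (continuous_id.mul continuous_const)).mul_const _
  obtain ⟨l, hl, hlz⟩ := intermediate_value_uIcc hcont.continuousOn (Icc_subset_uIcc hbounds)
  have hlL : l ∈ Llim i := by
    have hsub : uIcc (a i) (b i) ⊆ Icc (Llim i).fst (Llim i).snd :=
      uIcc_subset_Icc (ha i) (hb i)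
    exact hsub hl
  exact mem_mlComponent_iff.2 ⟨l, hlL, T, rfl, z 0 i, hz0 i, hlz⟩
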